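/- Let $m,n$ be non-negative integers and let $E$ be a (complex) linear subspace of the space $\mathbb{C}^{n\times m}$ of complex $n\times m$ matrices. For $A\in\mathbb{C}^{m\times n}$ define the structured singular value $\mu_E(A)\in[0,\infty]$ by $$\frac{1}{\mu_E(A)}=\inf\{\|X\| : X\in E,\ \det(1-AX)=0\},$$ where $\|X\|$ is the operator norm of $X$ with respect to the Euclidean norms and $\mu_E(A)=0$ if there is no such $X$. Let $\mathbb{D}$ be the open unit disc in $\mathbb{C}$. The Nevanlinna class $N$ consists of the holomorphic functions $f$ on $\mathbb{D}$ with $$\sup_{0<r<1}\frac{1}{2\pi}\int_0^{2\pi}\log^+|f(re^{i\theta})|\,d\theta<\infty,$$ and a matrix-valued function on $\mathbb{D}$ is said to belong to $N$ if each of its entries does. Let $\lambda_0\in\mathbb{D}\setminus\{0\}$ and $W\in\mathbb{C}^{m\times n}$. There exists a holomorphic function $F:\mathbb{D}\to\mathbb{C}^{m\times n}$ in $N$ such that 1. $F(0)=0$ and $F(\lambda_0)=W$, and 2. $\mu_E(F(\lambda))<1$ for all $\lambda\in\mathbb{D}$ if and only if $\mu_E(W)\le|\lambda_0|$. -/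

import Mathlib

open scoped Matrix.Norms.L2Operator in
/-- The structured singular value `μ_E(A) ∈ [0, ∞]` of an `m × n` complex matrix `A`
corresponding to the linear subspace `E` of the `n × m` complex matrices:
`1 / μ_E(A) = inf {‖X‖ : X ∈ E, det (1 - A X) = 0}`, where `‖X‖` is the operator norm of `X`
between Euclidean spaces. The infimum is taken in `[0, ∞]`, so that `μ_E(A) = 0` when there is
no such `X`. -/
noncomputable def structuredSingularValue {m n : ℕ}
    (E : Submodule ℂ (Matrix (Fin n) (Fin m) ℂ)) (A : Matrix (Fin m) (Fin n) ℂ) : ENNReal :=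
  (⨅ (X : Matrix (Fin n) (Fin m) ℂ) (_ : X ∈ E ∧ (1 - A * X).det = 0), ‖X‖ₑ)⁻¹

/-- The Nevanlinna class of the open unit disc: the holomorphic functions `f` on the disc for
which the circular means `(2π)⁻¹ ∫ log⁺ |f (r e^{iθ})| dθ` are bounded for `0 < r < 1`. -/
def IsNevanlinna (f : ℂ → ℂ) : Prop :=
  DifferentiableOn ℂ f (Metric.ball 0 1) ∧
    ∃ C : ℝ, ∀ r : ℝ, 0 < r → r < 1 →
      Real.circleAverage (fun z : ℂ => Real.posLog ‖f z‖) 0 r ≤ C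

/-- A matrix-valued function on the open unit disc is holomorphic and belongs to the Nevanlinna
class when each of its entries does. -/
def IsMatrixNevanlinna {m n : ℕ} (F : ℂ → Matrix (Fin m) (Fin n) ℂ) : Prop :=
  ∀ i j, IsNevanlinna (fun z => F z i j)

/-! This is a Schwarz lemma. If `W` satisfies the bound, the linear map `z ↦ (z / lam₀) • W` works
by homogeneity. Conversely, `K z = F z / z` extends holomorphically over `0`. Were some `X ∈ E` with
`‖X‖ < 1 / |lam|` to make `1 - F lam * X` singular, deform the constant `1` to `det (1 - lam • K z *
X)`, which vanishes at `lam`. On a circle `|z| = r` near the unit circle no zero occurs, since `μ_E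
(F z) < 1`; so `zeroFree_of_homotopy` gives a contradiction. Only holomorphy of `F` is used here,
not its growth. -/

/-- A homotopy of holomorphic functions on a disc, zero-free on the boundary circle throughout and
zero-free on the closed disc at time `0`, is zero-free on the closed disc at time `1`. -/
theorem zeroFree_of_homotopy {r : ℝ} (hr : 0 < r) (f : ℝ → ℂ → ℂ)
    (hcont : ContinuousOn (fun p : ℝ × ℂ => f p.1 p.2)
      (Set.Icc (0 : ℝ) 1 ×ˢ Metric.closedBall (0 : ℂ) r))
    (hdiff : ∀ s ∈ Set.Icc (0 : ℝ) 1, DifferentiableOn ℂ (f s) (Metric.closedBall 0 r))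
    (hsphere : ∀ s ∈ Set.Icc (0 : ℝ) 1, ∀ z ∈ Metric.sphere (0 : ℂ) r, f s z ≠ 0)
    (hzero : ∀ z ∈ Metric.closedBall (0 : ℂ) r, f 0 z ≠ 0) :
    ∀ z ∈ Metric.closedBall (0 : ℂ) r, f 1 z ≠ 0 := by
  intro w hw hfw
  have hK : IsCompact (Set.Icc (0 : ℝ) 1 ×ˢ Metric.closedBall (0 : ℂ) r) :=
    isCompact_Icc.prod (isCompact_closedBall 0 r)
  have hL : IsCompact (Set.Icc (0 : ℝ) 1 ×ˢ Metric.sphere (0 : ℂ) r) :=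
    isCompact_Icc.prod (isCompact_sphere 0 r)
  have hLne : (Set.Icc (0 : ℝ) 1 ×ˢ Metric.sphere (0 : ℂ) r).Nonempty :=
    ⟨(0, (r : ℂ)), by simp [abs_of_pos hr]⟩
  obtain ⟨p, hpL, hpmin⟩ := hL.exists_isMinOn hLne
    (hcont.mono (Set.prod_mono_right Metric.sphere_subset_closedBall)).norm
  have hmpos : 0 < ‖f p.1 p.2‖ := norm_pos_iff.2 (hsphere _ hpL.1 _ hpL.2)
  have hZ : IsCompact ((Set.Icc (0 : ℝ) 1 ×ˢ Metric.closedBall (0 : ℂ) r) ∩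
      (fun p : ℝ × ℂ => f p.1 p.2) ⁻¹' {0}) :=
    hK.of_isClosed_subset (hcont.preimage_isClosed_of_isClosed hK.isClosed isClosed_singleton)
      Set.inter_subset_left
  -- `t` is the first time a zero appears. Before it, the maximum principle for `1 / f s` bounds `‖f
  -- s v‖` below by the minimum over the boundary cylinder, and the bound survives as `s → t`.
  obtain ⟨⟨t, v⟩, ⟨⟨ht, hv⟩, hfv⟩, hmin⟩ := hZ.exists_isMinOn
    ⟨(1, w), ⟨⟨by simp, hw⟩, hfw⟩⟩ continuous_fst.continuousOn
  simp only [Set.mem_preimage, Set.mem_singleton_iff] at hfv ht hv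
  have htpos : 0 < t := by
    refine lt_of_le_of_ne ht.1 fun h => ?_
    subst h
    exact hzero v hv hfv
  have hlow : ∀ s ∈ Set.Ico (0 : ℝ) t, ‖f p.1 p.2‖ ≤ ‖f s v‖ := by
    intro s hs
    have hs1 : s ∈ Set.Icc (0 : ℝ) 1 := ⟨hs.1, hs.2.le.trans ht.2⟩
    have hne : ∀ z ∈ Metric.closedBall (0 : ℂ) r, f s z ≠ 0 := by
      intro z hz h0
      have : t ≤ s := hmin (a := (s, z)) ⟨⟨hs1, hz⟩, h0⟩
      exact absurd hs.2 (not_lt.2 this)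
    have hinv : DiffContOnCl ℂ (fun z => (f s z)⁻¹) (Metric.ball 0 r) := by
      refine DifferentiableOn.diffContOnCl ?_
      rw [closure_ball _ hr.ne']
      exact (hdiff s hs1).inv hne
    have hbd := Complex.norm_le_of_forall_mem_frontier_norm_le (C := ‖f p.1 p.2‖⁻¹)
      Metric.isBounded_ball hinv (z := v) ?_ (by rwa [closure_ball _ hr.ne'])
    · rw [norm_inv] at hbd
      exact (inv_le_inv₀ (norm_pos_iff.2 (hne v hv)) hmpos).1 hbd
    · intro z hz
      rw [frontier_ball _ hr.ne'] at hz
      rw [norm_inv]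
      exact inv_anti₀ hmpos (hpmin (a := (s, z)) ⟨hs1, hz⟩)
  have hc : ContinuousOn (fun s => ‖f s v‖) (Set.Icc 0 t) := by
    refine (hcont.comp (f := fun s : ℝ => (s, v)) (by fun_prop) ?_).norm
    intro s hs
    exact ⟨⟨hs.1, hs.2.trans ht.2⟩, hv⟩
  have hlim : Filter.Tendsto (fun s => ‖f s v‖) (nhdsWithin t (Set.Ico 0 t)) (nhds ‖f t v‖) :=
    ((hc t ⟨htpos.le, le_rfl⟩).tendsto).mono_left (nhdsWithin_mono _ Set.Ico_subset_Icc_self)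
  have : (nhdsWithin t (Set.Ico 0 t)).NeBot := by
    rw [nhdsWithin_Ico_eq_nhdsLT htpos]
    infer_instance
  have hfin := ge_of_tendsto hlim (eventually_nhdsWithin_of_forall hlow)
  rw [hfv, norm_zero] at hfin
  exact absurd hmpos (not_lt.2 hfin)

open scoped Matrix.Norms.L2Operator in
theorem structuredSingularValue_le_iff {m n : ℕ} (E : Submodule ℂ (Matrix (Fin n) (Fin m) ℂ))
    (A : Matrix (Fin m) (Fin n) ℂ) (c : ENNReal) :
    structuredSingularValue E A ≤ c ↔ ∀ X ∈ E, (1 - A * X).det = 0 → c⁻¹ ≤ ‖X‖ₑ := by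
  rw [structuredSingularValue, ENNReal.inv_le_iff_inv_le]
  simp only [le_iInf_iff, and_imp]

open scoped Matrix.Norms.L2Operator in
theorem det_ne_zero_of_structuredSingularValue_lt_one {m n : ℕ}
    {E : Submodule ℂ (Matrix (Fin n) (Fin m) ℂ)} {A : Matrix (Fin m) (Fin n) ℂ}
    (h : structuredSingularValue E A < 1) {X : Matrix (Fin n) (Fin m) ℂ} (hX : X ∈ E)
    (hX1 : ‖X‖ ≤ 1) : (1 - A * X).det ≠ 0 := by
  intro h0
  have h1 := (structuredSingularValue_le_iff E A _).1 le_rfl X hX h0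
  have h2 : ‖X‖ₑ ≤ 1 := by
    rw [← ofReal_norm]
    simpa using ENNReal.ofReal_le_ofReal hX1
  exact absurd (h1.trans h2) (not_le.2 (ENNReal.one_lt_inv.2 h))

open scoped Matrix.Norms.L2Operator in
/-- Complex homogeneity of the structured singular value, as an inequality. -/
theorem structuredSingularValue_smul_le {m n : ℕ} (E : Submodule ℂ (Matrix (Fin n) (Fin m) ℂ))
    (A : Matrix (Fin m) (Fin n) ℂ) (c : ℂ) :
    structuredSingularValue E (c • A) ≤ ‖c‖ₑ * structuredSingularValue E A := by
  rw [structuredSingularValue_le_iff]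
  intro X hX h0
  have h1 : (1 - A * (c • X)).det = 0 := by rwa [Matrix.mul_smul, ← Matrix.smul_mul]
  have h2 := (structuredSingularValue_le_iff E A _).1 le_rfl _ (E.smul_mem c hX) h1
  rcases eq_or_ne c 0 with rfl | hc
  · simp at h0
  have hc0 : ‖c‖ₑ ≠ 0 := by simpa using hc
  rw [enorm_smul] at h2
  rw [ENNReal.mul_inv (Or.inl hc0) (Or.inl enorm_ne_top)]
  calc ‖c‖ₑ⁻¹ * (structuredSingularValue E A)⁻¹ ≤ ‖c‖ₑ⁻¹ * (‖c‖ₑ * ‖X‖ₑ) := by gcongr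
    _ = ‖X‖ₑ := by rw [← mul_assoc, ENNReal.inv_mul_cancel hc0 enorm_ne_top, one_mul]

/-- Linear functions are in the Nevanlinna class of the disc. -/
theorem isNevanlinna_mul_const (a : ℂ) : IsNevanlinna (fun z => z * a) := by
  refine ⟨by fun_prop, Real.posLog ‖a‖, fun r hr hr1 => ?_⟩
  have h : ∀ z ∈ Metric.sphere (0 : ℂ) |r|,
      Real.posLog ‖z * a‖ = Function.const ℂ (Real.posLog (r * ‖a‖)) z := by
    intro z hz
    rw [mem_sphere_zero_iff_norm, abs_of_pos hr] at hz
    rw [norm_mul, hz, Function.const_apply]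
  rw [Real.circleAverage_congr_sphere h]
  rw [show Function.const ℂ (Real.posLog (r * ‖a‖)) = fun _ => Real.posLog (r * ‖a‖) from rfl,
    Real.circleAverage_const]
  exact Real.posLog_le_posLog (by positivity) (mul_le_of_le_one_left (norm_nonneg a) hr1.le)

open scoped Matrix.Norms.L2Operator in
/-- Schwarz lemma for the structured singular value. -/
theorem structuredSingularValue_le_of_schwarz {m n : ℕ}
    (E : Submodule ℂ (Matrix (Fin n) (Fin m) ℂ)) {lam : ℂ} (hlam : lam ∈ Metric.ball (0 : ℂ) 1)
    (hne : lam ≠ 0) (F : ℂ → Matrix (Fin m) (Fin n) ℂ)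
    (hF : ∀ i j, DifferentiableOn ℂ (fun z => F z i j) (Metric.ball 0 1)) (hF0 : F 0 = 0)
    (hμ : ∀ z ∈ Metric.ball (0 : ℂ) 1, structuredSingularValue E (F z) < 1) :
    structuredSingularValue E (F lam) ≤ ‖lam‖ₑ := by
  rw [structuredSingularValue_le_iff]
  intro X hX h0
  by_contra hlt
  have hXlam : ‖lam‖ * ‖X‖ < 1 := by
    rw [not_le, ← ofReal_norm, ← ofReal_norm, ← ENNReal.ofReal_inv_of_pos (norm_pos_iff.2 hne),
      ENNReal.ofReal_lt_ofReal_iff (inv_pos.2 (norm_pos_iff.2 hne))] at hlt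
    calc ‖lam‖ * ‖X‖ < ‖lam‖ * ‖lam‖⁻¹ := by
          have := norm_pos_iff.2 hne
          gcongr
      _ = 1 := mul_inv_cancel₀ (norm_ne_zero_iff.2 hne)
  rw [mem_ball_zero_iff] at hlam
  obtain ⟨r, hr, hr1⟩ := exists_between (max_lt hlam hXlam)
  rw [max_lt_iff] at hr
  have hr0 : 0 < r := (norm_nonneg _).trans_lt hr.1
  have hsub : Metric.closedBall (0 : ℂ) r ⊆ Metric.ball 0 1 := Metric.closedBall_subset_ball hr1
  -- `dslope` takes the value of the derivative at `0`, which removes the singularity of `F z / z`.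
  let K : ℂ → Matrix (Fin m) (Fin n) ℂ := fun z => Matrix.of fun i j => dslope (fun z => F z i j) 0 z
  have hK : ∀ i j, DifferentiableOn ℂ (fun z => K z i j) (Metric.closedBall 0 r) := fun i j =>
    ((Complex.differentiableOn_dslope (Metric.ball_mem_nhds 0 one_pos)).2 (hF i j)).mono hsub
  have hKF : ∀ z, z ≠ 0 → K z = z⁻¹ • F z := by
    intro z hz
    ext i j
    simp [K, dslope_of_ne _ hz, slope_def_field, hF0, div_eq_inv_mul]
  have hKc : ContinuousOn K (Metric.closedBall 0 r) :=
    continuousOn_pi.2 fun i => continuousOn_pi.2 fun j => (hK i j).continuousOn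
  refine zeroFree_of_homotopy hr0 (fun s z => (1 - ((s : ℂ) * lam) • (K z * X)).det)
    ?_ ?_ ?_ (by simp) lam (by simpa using hr.1.le) ?_
  · have h1 : ContinuousOn (fun p : ℝ × ℂ => K p.2)
        (Set.Icc (0 : ℝ) 1 ×ˢ Metric.closedBall (0 : ℂ) r) :=
      hKc.comp continuousOn_snd fun p hp => hp.2
    have h2 : ContinuousOn (fun p : ℝ × ℂ => 1 - ((p.1 : ℂ) * lam) • (K p.2 * X))
        (Set.Icc (0 : ℝ) 1 ×ˢ Metric.closedBall (0 : ℂ) r) := by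
      refine continuousOn_const.sub (ContinuousOn.smul
        (f := fun p : ℝ × ℂ => (p.1 : ℂ) * lam) (by fun_prop) ?_)
      exact (continuous_id.matrix_mul continuous_const).comp_continuousOn h1
    exact (continuous_id.matrix_det).comp_continuousOn h2
  · intro s _
    simp only [Matrix.det_apply, Matrix.sub_apply, Matrix.smul_apply, Matrix.mul_apply]
    fun_prop
  · intro s hs z hz
    have hz' : ‖z‖ = r := by simpa using hz
    have hz0 : z ≠ 0 := norm_pos_iff.1 (hz' ▸ hr0)
    -- The scalar `s * lam / z` moves from `F z` onto `X`: `E` is a complex subspace, and the scaled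
    -- `X` has norm at most `|lam| ‖X‖ / r ≤ 1`.
    have hdet := det_ne_zero_of_structuredSingularValue_lt_one
      (hμ z (hsub (Metric.sphere_subset_closedBall hz)))
      (E.smul_mem (z⁻¹ * (s * lam)) hX) ?_
    · rwa [hKF z hz0, Matrix.smul_mul, smul_smul, mul_comm, ← Matrix.mul_smul]
    · rw [norm_smul, norm_mul, norm_inv, norm_mul, hz', Complex.norm_real, Real.norm_of_nonneg hs.1,
        mul_assoc, inv_mul_le_one₀ hr0]
      calc s * ‖lam‖ * ‖X‖ ≤ 1 * ‖lam‖ * ‖X‖ := by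
            gcongr
            exact hs.2
        _ ≤ r := by rw [one_mul]; exact hr.2.le
  · simpa [hKF lam hne, smul_smul, hne] using h0

theorem mainTheorem12 {m n : ℕ} (E : Submodule ℂ (Matrix (Fin n) (Fin m) ℂ))
    (lam₀ : ℂ) (hlam₀ : lam₀ ∈ Metric.ball (0 : ℂ) 1) (hne : lam₀ ≠ 0)
    (W : Matrix (Fin m) (Fin n) ℂ) :
    (∃ F : ℂ → Matrix (Fin m) (Fin n) ℂ, IsMatrixNevanlinna F ∧ F 0 = 0 ∧ F lam₀ = W ∧
        ∀ z ∈ Metric.ball (0 : ℂ) 1, structuredSingularValue E (F z) < 1) ↔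
      structuredSingularValue E W ≤ ‖lam₀‖ₑ := by
  constructor
  · rintro ⟨F, hF, hF0, rfl, hμ⟩
    exact structuredSingularValue_le_of_schwarz E hlam₀ hne F (fun i j => (hF i j).1) hF0 hμ
  · intro hW
    have hl0 : ‖lam₀‖ₑ ≠ 0 := by simpa using hne
    refine ⟨fun z => (z * lam₀⁻¹) • W, fun i j => ?_, by simp, by simp [hne], fun z hz => ?_⟩
    · simpa [mul_assoc] using isNevanlinna_mul_const (lam₀⁻¹ * W i j)
    · calc structuredSingularValue E ((z * lam₀⁻¹) • W)
          ≤ ‖z * lam₀⁻¹‖ₑ * ‖lam₀‖ₑ :=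
            (structuredSingularValue_smul_le E W _).trans (by gcongr)
        _ = ‖z‖ₑ := by rw [← enorm_mul, inv_mul_cancel_right₀ hne]
        _ < 1 := by
          rw [mem_ball_zero_iff] at hz
          rwa [← ofReal_norm, ENNReal.ofReal_lt_one]
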